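/- A topological graph is a graph drawn in the plane: its vertices are distinct points, its edges are non-self-intersecting curves joining the corresponding points, no edge passes through a vertex other than its endpoints, and two edges that share an interior point properly cross there. It is simple if any two edges have at most one point in common. Two edges cross if they share a point that is not a vertex. A plane cycle is a cycle of the graph (of any length $k\ge 3$) no two of whose edges cross; the face it encloses (a face generated by the graph) is the bounded connected component of the complement of the closed curve it draws. Theorem. For every $n\ge 1$ there is a complete simple topological graph $D_n$ with vertices $v_1,\dots,v_n$, drawn in the unit square $[0,1]\times[0,1]$, such that every face generated by $D_n$ has area at least $\frac{1}{3n}$; in particular, every such face has area $\Omega(1/n)$. Moreover, $D_n$ can be chosen with the following properties. (i) For $i_1<i_2$ and $i_3<i_4$, the edges $v_{i_1}v_{i_2}$ and $v_{i_3}v_{i_4}$ cross if and only if $i_1<i_3<i_2<i_4$ or $i_3<i_1<i_4<i_2$. (ii) Every plane cycle in $D_n$ visits its vertices in increasing order: it can be written as $v_{i_1}\to v_{i_2}\to\dots\to v_{i_k}\to v_{i_1}$ with $i_1<i_2<\dots<i_k$, up to the choice of the starting vertex and the orientation. (iii) There are pairwise disjoint closed axis-parallel rectangles $R_1,\dots,R_n$,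 each of area $\frac{1}{3n}$, such that the face enclosed by any plane cycle $v_{i_1}\to\dots\to v_{i_k}\to v_{i_1}$ with $i_1<\dots<i_k$ contains $R_{i_2},\dots,R_{i_{k-1}}$. -/

import Mathlib

open Set MeasureTheory

/-- `A` is a non-self-intersecting curve in the plane with endpoints `p` and `q`:
the image of an injective continuous path from `p` to `q`. -/
def IsArc (A : Set (ℝ × ℝ)) (p q : ℝ × ℝ) : Prop :=
  ∃ γ : Path p q, Function.Injective γ ∧ Set.range γ = A

/-- The curves `A` and `B` properly cross at the point `x`: near `x`, the pair `(A, B)` looks, up to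
a homeomorphism, like the two coordinate axes near the origin. -/
def ProperCrossingAt (A B : Set (ℝ × ℝ)) (x : ℝ × ℝ) : Prop :=
  ∃ φ : OpenPartialHomeomorph (ℝ × ℝ) (ℝ × ℝ),
    x ∈ φ.source ∧ φ x = (0, 0) ∧
      ∀ y ∈ φ.source, (y ∈ A ↔ (φ y).2 = 0) ∧ (y ∈ B ↔ (φ y).1 = 0)

/-- A topological graph: a drawing of the graph `G` in the plane. Vertices are distinct points, each
edge is a non-self-intersecting curve joining the points of its two ends, no curve passes through a
vertex other than its endpoints, and two edges that share an interior point properly cross there. -/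
structure TopologicalGraph {V : Type*} (G : SimpleGraph V) where
  /-- the point that represents a vertex -/
  point : V → ℝ × ℝ
  /-- the curve that represents an edge (only the values on edges of `G` matter) -/
  curve : Sym2 V → Set (ℝ × ℝ)
  point_injective : Function.Injective point
  isArc_curve : ∀ u v : V, G.Adj u v → IsArc (curve s(u, v)) (point u) (point v)
  mem_of_point_mem_curve : ∀ e ∈ G.edgeSet, ∀ w : V, point w ∈ curve e → w ∈ e
  properCrossingAt : ∀ e ∈ G.edgeSet, ∀ f ∈ G.edgeSet, e ≠ f →
    ∀ x ∈ curve e ∩ curve f, x ∉ Set.range point → ProperCrossingAt (curve e) (curve f) x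

namespace TopologicalGraph

variable {V : Type*} {G : SimpleGraph V} (D : TopologicalGraph G)

/-- The topological graph is simple: any two edges intersect at most once. (By the definition of a
topological graph the intersection is then a common endpoint or a proper crossing.) -/
def IsSimple : Prop :=
  ∀ e ∈ G.edgeSet, ∀ f ∈ G.edgeSet, e ≠ f → (D.curve e ∩ D.curve f).Subsingleton

/-- The drawing lies in the unit square `[0,1] × [0,1]`. -/
def InUnitSquare : Prop :=
  (∀ v : V, D.point v ∈ Icc (0 : ℝ) 1 ×ˢ Icc (0 : ℝ) 1) ∧
    ∀ e ∈ G.edgeSet, D.curve e ⊆ Icc (0 : ℝ) 1 ×ˢ Icc (0 : ℝ) 1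

/-- Two distinct edges cross: their curves have a common point that is not a vertex. -/
def Cross (e f : Sym2 V) : Prop :=
  e ≠ f ∧ ∃ x ∈ D.curve e ∩ D.curve f, x ∉ Set.range D.point

/-- A closed walk that is a cycle of the graph and whose edges are pairwise non-crossing. -/
def IsPlaneCycle {v : V} (c : G.Walk v v) : Prop :=
  c.IsCycle ∧ ∀ e ∈ c.edges, ∀ f ∈ c.edges, ¬ D.Cross e f

/-- The closed curve in the plane that is drawn by a closed walk. -/
def trace {v : V} (c : G.Walk v v) : Set (ℝ × ℝ) :=
  ⋃ e ∈ c.edges, D.curve e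

/-- `F` is the face enclosed by the plane cycle `c`: the bounded cell cut out by `c`, that is, the
bounded connected component of the complement of the closed curve `D.trace c`. -/
def IsFaceOf {v : V} (c : G.Walk v v) (F : Set (ℝ × ℝ)) : Prop :=
  D.IsPlaneCycle c ∧ Bornology.IsBounded F ∧
    ∃ x ∈ (D.trace c)ᶜ, F = connectedComponentIn (D.trace c)ᶜ x

/-- `F` is a face generated by the topological graph: it is enclosed by some plane cycle. -/
def GeneratesFace (F : Set (ℝ × ℝ)) : Prop :=
  ∃ (v : V) (c : G.Walk v v), D.IsFaceOf c F

end TopologicalGraph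

/-- A closed (nondegenerate, axis-parallel) rectangle in the plane. -/
def IsClosedRectangle (R : Set (ℝ × ℝ)) : Prop :=
  ∃ a b c d : ℝ, a < b ∧ c < d ∧ R = Icc a b ×ˢ Icc c d

/-- The closed walk `c` visits its vertices in increasing order: up to the choice of its starting
vertex and of its orientation, the list of the vertices that it visits is strictly increasing. -/
def VisitsInIncreasingOrder {n : ℕ} {G : SimpleGraph (Fin n)} {v : Fin n} (c : G.Walk v v) : Prop :=
  ∃ l : List (Fin n), l.Pairwise (· < ·) ∧
    (l.IsRotated c.support.tail ∨ l.reverse.IsRotated c.support.tail)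

/-! Put the vertices on the horizontal axis and draw each edge, in coordinates `(U x, Ψ y)`, as an
arch of height `(u - a) * (b - u)`. All these parabolas have the same leading coefficient, so two
heights differ by an affine function of `u`. Hence two edges meet at most once, and they cross
exactly when their ends alternate. A plane cycle is then a noncrossing polygon on points in convex
position, so it is increasing (`strictMonoOn_of_noncrossing`), and its curve consists of one long
arch above a chain of consecutive short ones. Any point off the curve and outside the cell between
them escapes to infinity vertically, so a bounded face contains the cell
(`archCell_subset_of_isBounded`).

The areas come from the coordinates. `U` separates consecutive vertices by more than `1` but has
slope only `1 / 4` on a strip of width `2 / (3 n)` around each (`exists_staircase`). Over that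
strip, arches spanning the vertex have height at least `1`, while the others have height at most `1
/ 12`. So the rectangle on the strip with heights from `1 / 4` to `3 / 4`, of area `1 / (3 n)`, lies
in the cell whenever its vertex is intermediate. `Ψ` is the identity on those heights and squeezes
the tall arches into the unit square (`exists_steep_orderIso`). -/

/-- The difference of two arch heights is an affine function of the abscissa. -/
theorem arch_height_sub (a b c d u : ℝ) :
    (u - a) * (b - u) - (u - c) * (d - u) = (a + b - c - d) * u - (a * b - c * d) := by
  ring

theorem pair_eq_of_add_eq_of_mul_eq {a b c d : ℝ} (hs : a + b = c + d) (hp : a * b = c * d) :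
    (a = c ∧ b = d) ∨ (a = d ∧ b = c) := by
  have h : (a - c) * (a - d) = 0 := by
    have : b = c + d - a := by linarith
    subst this
    linarith
  rcases mul_eq_zero.mp h with h | h
  · left; constructor <;> linarith
  · right; constructor <;> linarith

/-! ### Parabolic arches and their crossings -/

section Arch

variable (U Ψ : ℝ ≃o ℝ)

/-- In the coordinates `(U x, Ψ y)`, the part in the upper half plane of the parabola that meets
the horizontal axis at the abscissas `a` and `b`. -/
def arch (a b : ℝ) : Set (ℝ × ℝ) :=
  {p | 0 ≤ p.2 ∧ Ψ p.2 = (U p.1 - a) * (b - U p.1)}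

theorem arch_comm (a b : ℝ) : arch U Ψ a b = arch U Ψ b a := by
  ext p
  simp only [arch, mem_ofPred_eq]
  rw [show (U p.1 - a) * (b - U p.1) = (U p.1 - b) * (a - U p.1) by ring]

variable {U Ψ}

theorem OrderIso.nonneg_iff_of_map_zero (hΨ : Ψ 0 = 0) (y : ℝ) : 0 ≤ Ψ y ↔ 0 ≤ y := by
  rw [← hΨ, Ψ.le_iff_le, hΨ]

theorem mem_Icc_of_mem_arch (hΨ : Ψ 0 = 0) {a b : ℝ} (hab : a ≤ b) {p : ℝ × ℝ}
    (hp : p ∈ arch U Ψ a b) : U p.1 ∈ Icc a b := by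
  have h : 0 ≤ (U p.1 - a) * (b - U p.1) := hp.2 ▸ (Ψ.nonneg_iff_of_map_zero hΨ _).2 hp.1
  constructor <;> by_contra! hlt <;> nlinarith

/-- The arch is a graph over the segment between its feet, so parametrizing it by the abscissa gives
injectivity. -/
theorem isArc_arch_of_lt (hΨ : Ψ 0 = 0) {a b : ℝ} (hab : a < b) :
    IsArc (arch U Ψ a b) (U.symm a, 0) (U.symm b, 0) := by
  have hAB : U.symm a < U.symm b := U.symm.lt_iff_lt.2 hab
  have hΨ' : Ψ.symm 0 = 0 := by rw [← hΨ, Ψ.symm_apply_apply, hΨ]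
  have hUc := U.continuous
  have hΨc := Ψ.symm.continuous
  let x : ℝ → ℝ := fun t => U.symm a + t * (U.symm b - U.symm a)
  have hx : Continuous x := by fun_prop
  refine ⟨⟨⟨fun t => (x t, Ψ.symm ((U (x t) - a) * (b - U (x t)))), ?_⟩, ?_, ?_⟩, ?_, ?_⟩
  · fun_prop
  · simp [x, hΨ']
  · simp [x, hΨ']
  · intro s t hst
    have h := congrArg Prod.fst hst
    simp only [Path.coe_mk_mk, x] at h
    have : (s : ℝ) = t := by
      have h2 : ((s : ℝ) - t) * (U.symm b - U.symm a) = 0 := by linarith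
      rcases mul_eq_zero.mp h2 with h | h <;> linarith
    exact Subtype.ext this
  · ext p
    simp only [Path.coe_mk_mk, mem_range]
    constructor
    · rintro ⟨t, rfl⟩
      have h1 : U.symm a ≤ x t := by
        have := mul_nonneg t.2.1 (sub_nonneg.2 hAB.le)
        simp only [x]; linarith
      have h2 : x t ≤ U.symm b := by
        have := mul_nonneg (sub_nonneg.2 t.2.2) (sub_nonneg.2 hAB.le)
        simp only [x]; linarith
      have h3 : a ≤ U (x t) := by simpa using U.monotone h1
      have h4 : U (x t) ≤ b := by simpa using U.monotone h2
      refine ⟨?_, by simp⟩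
      rw [← Ψ.nonneg_iff_of_map_zero hΨ]
      simpa using mul_nonneg (sub_nonneg.2 h3) (sub_nonneg.2 h4)
    · intro hp
      obtain ⟨h1, h2⟩ := mem_Icc_of_mem_arch hΨ hab.le hp
      have h3 : U.symm a ≤ p.1 := by simpa using U.symm.monotone h1
      have h4 : p.1 ≤ U.symm b := by simpa using U.symm.monotone h2
      have h5 : 0 < U.symm b - U.symm a := sub_pos.2 hAB
      refine ⟨⟨(p.1 - U.symm a) / (U.symm b - U.symm a), div_nonneg (by linarith) h5.le,
        (div_le_one h5).2 (by linarith)⟩, ?_⟩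
      have hxp : x ((p.1 - U.symm a) / (U.symm b - U.symm a)) = p.1 := by
        simp only [x]
        field_simp
        ring
      ext
      · exact hxp
      · simp only [hxp, ← hp.2, Ψ.symm_apply_apply]

theorem IsArc.symm {A : Set (ℝ × ℝ)} {p q : ℝ × ℝ} (h : IsArc A p q) : IsArc A q p := by
  obtain ⟨γ, hγ, rfl⟩ := h
  exact ⟨γ.symm, hγ.comp unitInterval.symm_bijective.injective, γ.symm_range⟩

theorem isArc_arch (hΨ : Ψ 0 = 0) {a b : ℝ} (hab : a ≠ b) :
    IsArc (arch U Ψ a b) (U.symm a, 0) (U.symm b, 0) := by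
  rcases hab.lt_or_gt with h | h
  · exact isArc_arch_of_lt hΨ h
  · rw [arch_comm]
    exact (isArc_arch_of_lt hΨ h).symm

/-- The coordinate system of the plane in which two arches with different axes of symmetry are the
coordinate axes. -/
noncomputable def archCoordinates (U Ψ : ℝ ≃o ℝ) (a b c d : ℝ) (h : a + b - c - d ≠ 0) :
    (ℝ × ℝ) ≃ₜ (ℝ × ℝ) :=
  have hU := U.continuous
  have hΨ := Ψ.continuous
  have hU' := U.symm.continuous
  have hΨ' := Ψ.symm.continuous
  -- The coordinates are the signed heights above the second and the first arch. Their difference is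
  -- affine in `U p.1` with slope `a + b - c - d`, so it recovers the abscissa.
  { toFun := fun p => (Ψ p.2 - (U p.1 - c) * (d - U p.1), Ψ p.2 - (U p.1 - a) * (b - U p.1))
    invFun := fun q =>
      (U.symm ((q.1 - q.2 + (a * b - c * d)) / (a + b - c - d)),
        Ψ.symm (q.1 + ((q.1 - q.2 + (a * b - c * d)) / (a + b - c - d) - c) *
          (d - (q.1 - q.2 + (a * b - c * d)) / (a + b - c - d))))
    left_inv := fun p => by
      have : (Ψ p.2 - (U p.1 - c) * (d - U p.1) - (Ψ p.2 - (U p.1 - a) * (b - U p.1)) +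
          (a * b - c * d)) / (a + b - c - d) = U p.1 := by
        rw [div_eq_iff h]
        ring
      simp only [this]
      ext <;> simp
    right_inv := fun q => by
      set u := (q.1 - q.2 + (a * b - c * d)) / (a + b - c - d) with hu
      have hu' : (a + b - c - d) * u = q.1 - q.2 + (a * b - c * d) := by
        rw [hu]
        field_simp
      ext
      · simp
      · simp only [OrderIso.apply_symm_apply]
        linarith [arch_height_sub a b c d u]
    continuous_toFun := by fun_prop
    continuous_invFun := by fun_prop }

theorem properCrossingAt_arch {a b c d : ℝ} (h : a + b - c - d ≠ 0) {p : ℝ × ℝ}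
    (hp : p ∈ arch U Ψ a b ∩ arch U Ψ c d) (hpos : 0 < p.2) :
    ProperCrossingAt (arch U Ψ a b) (arch U Ψ c d) p := by
  -- In the open upper half plane the sign condition in `arch` is automatic, so each arch is exactly
  -- the zero set of one coordinate.
  refine ⟨(archCoordinates U Ψ a b c d h).toOpenPartialHomeomorph.restrOpen {q | 0 < q.2}
    (isOpen_lt continuous_const continuous_snd), by simpa using hpos, ?_, ?_⟩
  · simp [archCoordinates, hp.1.2, ← hp.2.2]
  · intro q hq
    have hq' : 0 < q.2 := by simpa using hq
    simp [archCoordinates, arch, hq'.le, sub_eq_zero]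

section Drawing

variable {V : Type*}

/-- The complete topological graph whose vertices lie on the horizontal axis at the abscissas `a v`
and whose edges are arches, in the coordinates `(U x, Ψ y)`. -/
noncomputable def archDrawing (U Ψ : ℝ ≃o ℝ) (hΨ : Ψ 0 = 0) (a : V → ℝ)
    (ha : Function.Injective a) : TopologicalGraph (⊤ : SimpleGraph V) where
  point v := (U.symm (a v), 0)
  curve := Sym2.lift ⟨fun v w => arch U Ψ (a v) (a w), fun _ _ => arch_comm U Ψ _ _⟩
  point_injective v w h := ha (U.symm.injective (congrArg Prod.fst h))
  isArc_curve v w h := isArc_arch hΨ (ha.ne h.ne)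
  mem_of_point_mem_curve e _ w := by
    induction e with | _ i j => ?_
    rintro ⟨-, h⟩
    simp only [hΨ, OrderIso.apply_symm_apply] at h
    rcases mul_eq_zero.mp h.symm with h | h
    · exact ha (sub_eq_zero.mp h) ▸ Sym2.mem_mk_left _ _
    · exact ha (sub_eq_zero.mp h) ▸ Sym2.mem_mk_right _ _
  properCrossingAt e _ f _ hef p hp hpv := by
    induction e with | _ i j => ?_
    induction f with | _ k l => ?_
    have hp' : p ∈ arch U Ψ (a i) (a j) ∩ arch U Ψ (a k) (a l) := hp
    have hpos : 0 < p.2 := by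
      refine lt_of_le_of_ne hp'.1.1 fun h0 => hpv ?_
      have h := hp'.1.2
      rw [← h0, hΨ] at h
      rcases mul_eq_zero.mp h.symm with h | h
      · exact ⟨i, Prod.ext (by simp [← sub_eq_zero.mp h]) h0⟩
      · exact ⟨j, Prod.ext (by simp [sub_eq_zero.mp h]) h0⟩
    -- With equal sums of feet the two heights differ by a constant, which vanishes at a common
    -- point. Then the products agree too, and the edges coincide.
    refine properCrossingAt_arch (fun h => hef ?_) hp' hpos
    have h1 := arch_height_sub (a i) (a j) (a k) (a l) (U p.1)
    rw [← hp'.1.2, ← hp'.2.2, h] at h1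
    rcases pair_eq_of_add_eq_of_mul_eq (a := a i) (b := a j) (c := a k) (d := a l)
      (by linarith) (by linarith) with ⟨h2, h3⟩ | ⟨h2, h3⟩
    · rw [ha h2, ha h3]
    · rw [ha h2, ha h3, Sym2.eq_swap]

variable {hΨ : Ψ 0 = 0} {a : V → ℝ} {ha : Function.Injective a}

@[simp] theorem archDrawing_curve (v w : V) :
    (archDrawing U Ψ hΨ a ha).curve s(v, w) = arch U Ψ (a v) (a w) := rfl

theorem archDrawing_isSimple : (archDrawing U Ψ hΨ a ha).IsSimple := by
  intro e _ f _ hef p hp q hq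
  induction e with | _ i j => ?_
  induction f with | _ k l => ?_
  simp only [archDrawing_curve] at hp hq
  have h1 := arch_height_sub (a i) (a j) (a k) (a l) (U p.1)
  have h2 := arch_height_sub (a i) (a j) (a k) (a l) (U q.1)
  rw [← hp.1.2, ← hp.2.2] at h1
  rw [← hq.1.2, ← hq.2.2] at h2
  have h3 : (a i + a j - a k - a l) * (U p.1 - U q.1) = 0 := by linarith
  rcases mul_eq_zero.mp h3 with h | h
  · rw [h] at h1
    rcases pair_eq_of_add_eq_of_mul_eq (a := a i) (b := a j) (c := a k) (d := a l)
      (by linarith) (by linarith) with ⟨h2, h3⟩ | ⟨h2, h3⟩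
    · rw [ha h2, ha h3] at hef
      exact absurd rfl hef
    · rw [ha h2, ha h3, Sym2.eq_swap] at hef
      exact absurd rfl hef
  · have h4 : p.1 = q.1 := U.injective (sub_eq_zero.mp h)
    refine Prod.ext h4 (Ψ.injective ?_)
    rw [hp.1.2, hq.1.2, h4]

/-- A nonvertex point of an edge lies strictly between the ends of the edge. -/
theorem mem_Ioo_of_mem_arch {i j : V} (hij : a i ≤ a j) {p : ℝ × ℝ}
    (hp : p ∈ arch U Ψ (a i) (a j)) (hpv : p ∉ range (archDrawing U Ψ hΨ a ha).point) :
    U p.1 ∈ Ioo (a i) (a j) := by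
  obtain ⟨h1, h2⟩ := mem_Icc_of_mem_arch hΨ hij hp
  have key : ∀ k, U p.1 = a k → (U p.1 - a i) * (a j - U p.1) = 0 → False := by
    intro k hk h0
    refine hpv ⟨k, Prod.ext (by simp [archDrawing, ← hk]) (Ψ.injective ?_)⟩
    rw [hp.2, h0]
    exact hΨ
  refine ⟨h1.lt_of_ne fun h => key i h.symm ?_, h2.lt_of_ne fun h => key j h ?_⟩
  · rw [h]; ring
  · rw [h]; ring

theorem exists_mem_arch_of_alternate (hΨ : Ψ 0 = 0) {b c d e : ℝ} (h1 : b < c) (h2 : c < d)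
    (h3 : d < e) : ∃ p ∈ arch U Ψ b d ∩ arch U Ψ c e, 0 < p.2 := by
  have hpos : 0 < c + e - b - d := by linarith
  -- The zero of the affine difference of the two heights.
  set u := (c * e - b * d) / (c + e - b - d) with hu
  have hu' : (c + e - b - d) * u = c * e - b * d := by
    rw [hu]
    field_simp
  have hcu : c < u := by
    rw [hu, lt_div_iff₀ hpos]
    nlinarith [mul_pos (sub_pos.2 h1) (sub_pos.2 h2)]
  have hud : u < d := by
    rw [hu, div_lt_iff₀ hpos]
    nlinarith [mul_pos (sub_pos.2 h2) (sub_pos.2 h3)]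
  have hh : 0 < (u - b) * (d - u) := mul_pos (by linarith) (by linarith)
  have hy : 0 < Ψ.symm ((u - b) * (d - u)) := by
    rw [← Ψ.lt_iff_lt, hΨ]
    simpa using hh
  refine ⟨(U.symm u, Ψ.symm ((u - b) * (d - u))), ⟨⟨hy.le, by simp⟩, hy.le, ?_⟩, hy⟩
  simp only [OrderIso.apply_symm_apply]
  linarith [arch_height_sub b d c e u]

theorem archDrawing_cross_iff [LinearOrder V] (hmono : StrictMono a) {i₁ i₂ i₃ i₄ : V}
    (h12 : i₁ < i₂) (h34 : i₃ < i₄) :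
    (archDrawing U Ψ hΨ a ha).Cross s(i₁, i₂) s(i₃, i₄) ↔
      (i₁ < i₃ ∧ i₃ < i₂ ∧ i₂ < i₄) ∨ (i₃ < i₁ ∧ i₁ < i₄ ∧ i₄ < i₂) := by
  have hvert : ∀ p : ℝ × ℝ, 0 < p.2 → p ∉ range (archDrawing U Ψ hΨ a ha).point := by
    rintro p hp ⟨v, rfl⟩
    exact lt_irrefl _ hp
  constructor
  · rintro ⟨hne, p, hp, hpv⟩
    simp only [archDrawing_curve] at hp
    obtain ⟨h1, h2⟩ := mem_Ioo_of_mem_arch (hmono h12).le hp.1 hpv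
    obtain ⟨h3, h4⟩ := mem_Ioo_of_mem_arch (hmono h34).le hp.2 hpv
    have heq := hp.1.2.symm.trans hp.2.2
    have h32 := hmono.lt_iff_lt.mp (h3.trans h2)
    have h14 := hmono.lt_iff_lt.mp (h1.trans h4)
    -- Of two nested parabolas the inner one is strictly lower over its open base, unless they are
    -- equal. This excludes every pattern but alternation.
    have hnest : ∀ b c d e u : ℝ, c ≤ b → b < u → u < d → d ≤ e →
        (u - b) * (d - u) = (u - c) * (e - u) → b = c ∧ d = e := by
      intro b c d e u hcb hbu hud hde h
      have p1 : 0 < u - b := by linarith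
      have p2 : 0 < d - u := by linarith
      constructor
      · by_contra hbc
        have : c < b := lt_of_le_of_ne hcb (Ne.symm hbc)
        nlinarith [mul_pos (sub_pos.2 this) p2, mul_nonneg (by linarith : 0 ≤ u - c)
          (sub_nonneg.2 hde)]
      · by_contra hde'
        have : d < e := lt_of_le_of_ne hde hde'
        nlinarith [mul_pos p1 (sub_pos.2 this), mul_nonneg (sub_nonneg.2 hcb)
          (by linarith : 0 ≤ e - u)]
    rcases lt_or_ge i₁ i₃ with h | h
    · rcases lt_or_ge i₂ i₄ with h' | h'
      · exact Or.inl ⟨h, h32, h'⟩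
      · have := hnest _ _ _ _ _ (hmono.monotone h.le) h3 h4 (hmono.monotone h') heq.symm
        exact absurd (ha this.1) h.ne'
    · rcases lt_or_ge i₄ i₂ with h' | h'
      · rcases h.eq_or_lt with rfl | h
        · have := hnest _ _ _ _ _ le_rfl h3 h4 (hmono.monotone h'.le) heq.symm
          exact absurd (ha this.2) h'.ne
        · exact Or.inr ⟨h, h14, h'⟩
      · have := hnest _ _ _ _ _ (hmono.monotone h) h1 h2 (hmono.monotone h') heq
        rw [ha this.1, ha this.2] at hne
        exact absurd rfl hne
  · rintro (⟨h1, h2, h3⟩ | ⟨h1, h2, h3⟩)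
    · obtain ⟨p, hp, hpos⟩ := exists_mem_arch_of_alternate (U := U) hΨ (hmono h1) (hmono h2)
        (hmono h3)
      exact ⟨by simp [h1.ne, (h1.trans h34).ne], p, hp, hvert p hpos⟩
    · obtain ⟨p, hp, hpos⟩ := exists_mem_arch_of_alternate (U := U) hΨ (hmono h1) (hmono h2)
        (hmono h3)
      exact ⟨by simp [h1.ne', h2.ne], p, hp.symm, hvert p hpos⟩

end Drawing

end Arch

/-! ### Noncrossing cycles on points in convex position -/

/-- A closed sequence of pairwise noncrossing chords between points in convex position that starts
at the least point visits the points in increasing order, if it is oriented suitably. -/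
theorem strictMonoOn_of_noncrossing {α : Type*} [LinearOrder α] {E : α → α → Prop} {k : ℕ}
    {w : ℕ → α} (hk : w k = w 0) (hinj : InjOn w (Iio k)) (hmin : ∀ i < k, w 0 ≤ w i)
    (hlast : w 1 ≤ w (k - 1)) (hsymm : ∀ a b, E a b → E b a) (hE : ∀ i < k, E (w i) (w (i + 1)))
    (hcross : ∀ a b c d, E a b → E c d → ¬ (a < c ∧ c < b ∧ b < d)) :
    StrictMonoOn w (Iio k) := by
  have key : ∀ i j, i < j → j < k → w i < w j := by
    intro i
    induction i with
    | zero =>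
      intro j hj hjk
      exact lt_of_le_of_ne (hmin j hjk) fun h => by
        have := hinj (show (0 : ℕ) ∈ Iio k from hj.trans hjk) hjk h
        omega
    | succ i ih =>
      intro j hj hjk
      by_contra hlt
      have hne : ∀ r s, r < k → s < k → r ≠ s → w r ≠ w s := fun r s hr hs hrs h =>
        hrs (hinj hr hs h)
      have hbase : w i < w j ∧ w j < w (i + 1) :=
        ⟨ih j (by omega) hjk, lt_of_le_of_ne (not_lt.mp hlt) (hne _ _ hjk (by omega) (by omega))⟩
      -- Once the sequence enters the interval below the chord from `w i` to `w (i + 1)`, it stays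
      -- there: `ih` prevents leaving at the bottom, and leaving at the top would cross the chord.
      have hprop : ∀ r, j + r < k → w i < w (j + r) ∧ w (j + r) < w (i + 1) := by
        intro r
        induction r with
        | zero => exact fun _ => hbase
        | succ r ihr =>
          intro hr
          obtain ⟨h1, h2⟩ := ihr (by omega)
          refine ⟨ih _ (by omega) hr, ?_⟩
          by_contra h3
          have h4 : w (i + 1) < w (j + (r + 1)) :=
            lt_of_le_of_ne (not_lt.mp h3) (hne _ _ (by omega) hr (by omega))
          exact hcross _ _ _ _ (hE i (by omega)) (hE (j + r) (by omega)) ⟨h1, h2, h4⟩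
      -- The last vertex is trapped as well. For `i = 0` this contradicts the orientation; otherwise
      -- the closing chord to `w 0` crosses the chord from `w i` to `w (i + 1)`.
      have hend := hprop (k - 1 - j) (by omega)
      rw [show j + (k - 1 - j) = k - 1 by omega] at hend
      rcases Nat.eq_zero_or_pos i with rfl | hi
      · exact absurd hlast (not_le.mpr hend.2)
      · have h0 : w 0 < w i :=
          lt_of_le_of_ne (hmin i (by omega)) (hne _ _ (by omega) (by omega) (by omega))
        have hclose : E (w (k - 1)) (w 0) := by
          have := hE (k - 1) (by omega)
          rwa [show k - 1 + 1 = k by omega, hk] at this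
        exact hcross _ _ _ _ (hsymm _ _ hclose) (hE i (by omega)) ⟨h0, hend.1, hend.2⟩
  intro i _ j hj hij
  exact key i j hij hj

theorem List.isRotated_dropLast_tail {α : Type*} {l : List α} (hl : 2 ≤ l.length)
    (h : l.head? = l.getLast?) : l.dropLast.IsRotated l.tail := by
  obtain ⟨x, t, rfl⟩ := List.exists_cons_of_length_pos (by omega : 0 < l.length)
  have ht : t ≠ [] := by rintro rfl; simp at hl
  have hx : t.getLast ht = x := by
    rw [List.getLast?_cons_of_ne_nil ht, List.getLast?_eq_getLast_of_ne_nil ht] at h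
    simpa using h.symm
  refine ⟨1, ?_⟩
  rw [List.dropLast_cons_of_ne_nil ht, List.tail_cons, List.rotate_cons_succ, List.rotate_zero]
  conv_rhs => rw [← List.dropLast_append_getLast ht, hx]

namespace SimpleGraph.Walk

variable {V : Type*} {G : SimpleGraph V}

theorem mem_edges_iff_exists_getVert {u v : V} (p : G.Walk u v) (e : Sym2 V) :
    e ∈ p.edges ↔ ∃ i < p.length, e = s(p.getVert i, p.getVert (i + 1)) := by
  constructor
  · intro he
    obtain ⟨d, hd, rfl⟩ := List.mem_map.mp he
    obtain ⟨i, hi, rfl⟩ := List.getElem_of_mem hd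
    refine ⟨i, by simpa using hi, ?_⟩
    rw [darts_getElem_eq_getVert]
    rfl
  · rintro ⟨i, hi, rfl⟩
    have hi' : i < p.darts.length := by simpa using hi
    refine List.mem_map.mpr ⟨p.darts[i], List.getElem_mem _, ?_⟩
    rw [darts_getElem_eq_getVert]
    rfl

/-- A cycle with pairwise noncrossing edges on vertices in convex position can be traversed from
its least vertex in increasing order. -/
theorem IsCycle.exists_strictMonoOn_getVert [LinearOrder V] {v : V} {c : G.Walk v v}
    (hc : c.IsCycle)
    (hcross : ∀ a b x y, s(a, b) ∈ c.edges → s(x, y) ∈ c.edges → ¬ (a < x ∧ x < b ∧ b < y)) :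
    ∃ (u : V) (c' : G.Walk u u), c'.IsCycle ∧ (∀ e, e ∈ c'.edges ↔ e ∈ c.edges) ∧
      (∀ x, x ∈ c'.support ↔ x ∈ c.support) ∧ StrictMonoOn c'.getVert (Iio c'.length) ∧
      (c'.support.dropLast.IsRotated c.support.tail ∨
        c'.support.dropLast.reverse.IsRotated c.support.tail) := by
  obtain ⟨u, hu, hmin⟩ : ∃ u ∈ c.support, ∀ x ∈ c.support, u ≤ x := by
    have hne : c.support.toFinset.Nonempty := ⟨v, by simp⟩
    refine ⟨c.support.toFinset.min' hne, List.mem_toFinset.mp (Finset.min'_mem _ _), fun x hx => ?_⟩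
    exact Finset.min'_le _ _ (List.mem_toFinset.mpr hx)
  have main : ∀ d : G.Walk u u, d.IsCycle → (∀ e, e ∈ d.edges ↔ e ∈ c.edges) →
      (∀ x, x ∈ d.support ↔ x ∈ c.support) → d.getVert 1 ≤ d.getVert (d.length - 1) →
      StrictMonoOn d.getVert (Iio d.length) := by
    intro d hd he hs hlast
    have h3 := hd.three_le_length
    refine strictMonoOn_of_noncrossing (E := fun a b => s(a, b) ∈ c.edges) (by simp) ?_ ?_ hlast
      (fun a b h => by rwa [Sym2.eq_swap]) ?_ hcross
    · exact hd.getVert_injOn'.mono fun i (hi : i < d.length) => by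
        show i ≤ d.length - 1
        omega
    · intro i _
      simpa using hmin _ ((hs _).mp (d.getVert_mem_support i))
    · intro i hi
      exact (he _).mp ((d.mem_edges_iff_exists_getVert _).mpr ⟨i, hi, rfl⟩)
  have hrot : ∀ d : G.Walk u u, d.IsCycle → d.support.dropLast.IsRotated d.support.tail := by
    intro d hd
    have h3 := hd.three_le_length
    refine List.isRotated_dropLast_tail (by simp; omega) ?_
    rw [List.head?_eq_some_head d.support_ne_nil, List.getLast?_eq_some_getLast d.support_ne_nil]
    simp
  set d := c.rotate u hu with hd
  have hdc : d.IsCycle := hc.rotate hu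
  have hde : ∀ e, e ∈ d.edges ↔ e ∈ c.edges := fun e => (c.rotate_edges u hu).mem_iff
  have hds : ∀ x, x ∈ d.support ↔ x ∈ c.support := fun x => c.mem_support_rotate_iff u hu
  have hdr : d.support.tail.IsRotated c.support.tail := c.support_rotate u hu
  have h3 := hdc.three_le_length
  -- Reverse the cycle if necessary, so that the second vertex is not above the last.
  rcases le_total (d.getVert 1) (d.getVert (d.length - 1)) with h | h
  · exact ⟨u, d, hdc, hde, hds, main d hdc hde hds h, Or.inl ((hrot d hdc).trans hdr)⟩
  · refine ⟨u, d.reverse, hdc.reverse, by simpa using hde, by simpa using hds,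
      main _ hdc.reverse (by simpa using hde) (by simpa using hds) ?_, Or.inr ?_⟩
    · rw [getVert_reverse, getVert_reverse, length_reverse, Nat.sub_sub_self (by omega)]
      exact h
    · rw [support_reverse]
      have : d.support.reverse.dropLast.reverse = d.support.tail := by
        rw [List.dropLast_reverse, List.reverse_reverse]
      rw [this]
      exact hdr

end SimpleGraph.Walk

/-! ### The two coordinate changes -/

/-- A strictly increasing continuous function that is unbounded in both directions is an
order isomorphism of the line. -/
theorem exists_orderIso_of_strictMono_of_tendsto {f : ℝ → ℝ} (hf : StrictMono f)
    (hc : Continuous f) (htop : Filter.Tendsto f Filter.atTop Filter.atTop)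
    (hbot : Filter.Tendsto f Filter.atBot Filter.atBot) : ∃ e : ℝ ≃o ℝ, ∀ x, e x = f x :=
  ⟨hf.orderIsoOfSurjective f (hc.surjective htop hbot), fun _ => rfl⟩

/-- The abscissa of the vertex number `k`. -/
noncomputable def abscissa (n k : ℕ) : ℝ := (2 * k + 1) / (2 * n)

/-- A smoothed staircase: a coordinate change of the line that is almost constant around each of the
first `n` abscissas, and increases by a little more than `1` between two of them. -/
theorem exists_staircase {n : ℕ} (hn : 1 ≤ n) :
    ∃ U : ℝ ≃o ℝ, ∀ k < n, ∀ x : ℝ, |x - abscissa n k| ≤ 1 / (3 * n) → U x = x / 4 + k := by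
  have hn0 : (0 : ℝ) < n := by exact_mod_cast hn
  -- The summand `j` climbs from `0` to `1` while `n * x - j` runs from `5 / 6` to `7 / 6`, exactly
  -- the gap between the strips around the abscissas `j` and `j + 1`. The added `x / 4` gives strict
  -- monotonicity and surjectivity.
  let s : ℝ → ℝ := fun x => ∑ j ∈ Finset.range n, max 0 (min 1 (3 * (n * x - j) - 5 / 2))
  have hs : Monotone s := fun x y hxy => Finset.sum_le_sum fun j _ => by gcongr
  have hs0 : ∀ x, 0 ≤ s x := fun x => Finset.sum_nonneg fun j _ => le_max_left _ _
  have hsn : ∀ x, s x ≤ n := fun x => by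
    refine (Finset.sum_le_card_nsmul _ _ 1 fun j _ => max_le zero_le_one (min_le_left _ _)).trans ?_
    simp
  have hsc : Continuous s := by fun_prop
  have h4 : StrictMono fun x : ℝ => x / 4 := fun x y hxy => by dsimp only; linarith
  obtain ⟨U, hU⟩ := exists_orderIso_of_strictMono_of_tendsto (f := fun x => x / 4 + s x)
    (h4.add_monotone hs) (by fun_prop)
    (Filter.tendsto_atTop_mono (fun x => le_add_of_nonneg_right (hs0 x))
      (Filter.tendsto_id.atTop_div_const (by norm_num)))
    (Filter.tendsto_atBot_mono (fun x => add_le_add_right (hsn x) _)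
      (Filter.tendsto_atBot_add_const_right _ _
        (Filter.tendsto_id.atBot_div_const (by norm_num))))
  refine ⟨U, fun k hk x hx => ?_⟩
  rw [hU]
  congr 1
  have hx' : |n * x - k - 1 / 2| ≤ 1 / 3 := by
    have : n * x - k - 1 / 2 = n * (x - abscissa n k) := by
      rw [abscissa]
      field_simp
      ring
    rw [this, abs_mul, abs_of_pos hn0]
    calc (n : ℝ) * |x - abscissa n k| ≤ n * (1 / (3 * n)) := by gcongr
      _ = 1 / 3 := by field_simp
  obtain ⟨h1, h2⟩ := abs_le.mp hx'
  have hterm : ∀ j ∈ Finset.range n,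
      max 0 (min 1 (3 * ((n : ℝ) * x - j) - 5 / 2)) = if j < k then 1 else 0 := by
    intro j _
    split_ifs with hj
    · have : (j : ℝ) + 1 ≤ k := by exact_mod_cast hj
      rw [min_eq_left (by linarith), max_eq_right zero_le_one]
    · have : (k : ℝ) ≤ j := by exact_mod_cast not_lt.mp hj
      rw [max_eq_left ((min_le_right _ _).trans (by linarith))]
  show s x = k
  simp only [s]
  rw [Finset.sum_congr rfl hterm, Finset.sum_boole]
  have : (Finset.range n).filter (· < k) = Finset.range k := by
    ext j
    simp only [Finset.mem_filter, Finset.mem_range]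
    omega
  rw [this, Finset.card_range]

/-- A coordinate change of the line that is the identity up to `3 / 4` and reaches `M` at `1`. -/
theorem exists_steep_orderIso {M : ℝ} (hM : 0 ≤ M) :
    ∃ Ψ : ℝ ≃o ℝ, (∀ y ≤ 3 / 4, Ψ y = y) ∧ M ≤ Ψ 1 := by
  have hm : Monotone fun y : ℝ => 4 * M * max 0 (y - 3 / 4) := fun x y hxy => by
    dsimp only
    gcongr
  have h0 : ∀ y : ℝ, 0 ≤ 4 * M * max 0 (y - 3 / 4) := fun y => by positivity
  obtain ⟨Ψ, hΨ⟩ := exists_orderIso_of_strictMono_of_tendsto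
    (f := fun y => y + 4 * M * max 0 (y - 3 / 4))
    (strictMono_id.add_monotone hm) (by fun_prop)
    (Filter.tendsto_atTop_mono (fun y => le_add_of_nonneg_right (h0 y)) Filter.tendsto_id)
    (Filter.tendsto_id.congr' <| by
      filter_upwards [Filter.eventually_le_atBot (3 / 4)] with y hy
      rw [max_eq_left (by linarith)]
      simp)
  refine ⟨Ψ, fun y hy => ?_, ?_⟩
  · rw [hΨ, max_eq_left (by linarith)]
    simp
  · rw [hΨ, max_eq_right (by norm_num)]
    linarith

/-! ### The cell bounded by a polygon of arches -/

theorem not_isBounded_image_prodMk_of_Ici {x y : ℝ} :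
    ¬ Bornology.IsBounded (Prod.mk x '' Ici y) := by
  intro h
  have := h.image_snd
  rw [image_image] at this
  exact not_bddAbove_Ici y (by simpa using this.bddAbove)

theorem not_isBounded_image_prodMk_of_Iic {x y : ℝ} :
    ¬ Bornology.IsBounded (Prod.mk x '' Iic y) := by
  intro h
  have := h.image_snd
  rw [image_image] at this
  exact not_bddBelow_Iic y (by simpa using this.bddBelow)

/-- The component of a planar set that contains an unbounded vertical ray is
unbounded. -/
theorem not_isBounded_connectedComponentIn {S : Set (ℝ × ℝ)} {x y : ℝ}
    (h : (∀ y' ≥ y, (x, y') ∈ S) ∨ ∀ y' ≤ y, (x, y') ∈ S) :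
    ¬ Bornology.IsBounded (connectedComponentIn S (x, y)) := by
  intro hb
  have hc : Continuous (Prod.mk x : ℝ → ℝ × ℝ) := by fun_prop
  rcases h with h | h
  · refine not_isBounded_image_prodMk_of_Ici (x := x) (y := y) (hb.subset ?_)
    refine (isPreconnected_Ici.image _ hc.continuousOn).subset_connectedComponentIn
      (mem_image_of_mem _ self_mem_Ici) ?_
    rintro _ ⟨y', hy', rfl⟩
    exact h y' hy'
  · refine not_isBounded_image_prodMk_of_Iic (x := x) (y := y) (hb.subset ?_)
    refine (isPreconnected_Iic.image _ hc.continuousOn).subset_connectedComponentIn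
      (mem_image_of_mem _ self_mem_Iic) ?_
    rintro _ ⟨y', hy', rfl⟩
    exact h y' hy'

section Cell

variable {U Ψ : ℝ ≃o ℝ}

/-- The closed curve formed by the arches between consecutive terms of `s 0, …, s m` and the arch
between `s 0` and `s m`. -/
def archPolygon (U Ψ : ℝ ≃o ℝ) (s : ℕ → ℝ) (m : ℕ) : Set (ℝ × ℝ) :=
  arch U Ψ (s 0) (s m) ∪ ⋃ i < m, arch U Ψ (s i) (s (i + 1))

/-- The cell below the arch between `s 0` and `s m` and above the arches between consecutive terms
of `s 0, …, s m`. -/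
def archCell (U Ψ : ℝ ≃o ℝ) (s : ℕ → ℝ) (m : ℕ) : Set (ℝ × ℝ) :=
  {p | U p.1 ∈ Ioo (s 0) (s m) ∧ Ψ p.2 < (U p.1 - s 0) * (s m - U p.1) ∧
    ∀ i < m, (U p.1 - s i) * (s (i + 1) - U p.1) < Ψ p.2}

variable {s : ℕ → ℝ} {m : ℕ}

theorem arch_height_lt_of_nested {a b c d u : ℝ} (hca : c ≤ a) (hab : a < b) (hbd : b ≤ d)
    (hne : c < a ∨ b < d) (hu : u ∈ Ioo c d) : (u - a) * (b - u) < (u - c) * (d - u) := by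
  obtain ⟨h1, h2⟩ := hu
  have hpos : 0 < (u - c) * (d - u) := mul_pos (by linarith) (by linarith)
  rcases le_or_gt u a with h | h
  · nlinarith
  rcases le_or_gt b u with h' | h'
  · nlinarith
  rcases hne with h3 | h3
  · nlinarith [mul_pos (sub_pos.2 h3) (sub_pos.2 h'),
      mul_nonneg (sub_pos.2 h1).le (sub_nonneg.2 hbd)]
  · nlinarith [mul_pos (sub_pos.2 h) (sub_pos.2 h3),
      mul_nonneg (sub_nonneg.2 hca) (sub_pos.2 h2).le]

theorem arch_height_lt_of_consecutive (hm : 2 ≤ m) (hs : StrictMonoOn s (Iic m)) {i : ℕ}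
    (hi : i < m) {u : ℝ} (hu : u ∈ Ioo (s 0) (s m)) :
    (u - s i) * (s (i + 1) - u) < (u - s 0) * (s m - u) := by
  have h0 : (0 : ℕ) ∈ Iic m := Nat.zero_le m
  have hmm : m ∈ Iic m := le_refl m
  have hi' : i ∈ Iic m := hi.le
  have hi1 : i + 1 ∈ Iic m := hi
  refine arch_height_lt_of_nested (hs.monotoneOn h0 hi' (Nat.zero_le i)) (hs hi' hi1 (by omega))
    (hs.monotoneOn hi1 hmm hi) ?_ hu
  rcases Nat.eq_zero_or_pos i with rfl | h
  · exact Or.inr (hs hi1 hmm (by omega))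
  · exact Or.inl (hs h0 hi' h)

theorem isPreconnected_archCell (hm : 2 ≤ m) (hs : StrictMonoOn s (Iic m)) :
    IsPreconnected (archCell U Ψ s m) := by
  have hne : (Finset.range m).Nonempty := ⟨0, by simp; omega⟩
  let l : ℝ → ℝ := fun u =>
    (Finset.range m).sup' hne fun i => (u - s i) * (s (i + 1) - u)
  have hl : Continuous l := Continuous.finset_sup'_apply hne fun i _ => by fun_prop
  let t : ℝ → ℝ := fun u => (u - s 0) * (s m - u)
  have ht : Continuous t := by fun_prop
  have hlt : ∀ u ∈ Ioo (s 0) (s m), l u < t u := fun u hu => by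
    rw [Finset.sup'_lt_iff]
    exact fun i hi => arch_height_lt_of_consecutive hm hs (Finset.mem_range.1 hi) hu
  have hU := U.symm.continuous
  have hΨ := Ψ.symm.continuous
  let f : ℝ × ℝ → ℝ × ℝ := fun q =>
    (U.symm q.1, Ψ.symm (l q.1 + q.2 * (t q.1 - l q.1)))
  have hf : Continuous f := by fun_prop
  -- The cell is swept out by interpolating vertically between the upper envelope `l` of the short
  -- arches and the long arch `t`, so it is a continuous image of an open rectangle.
  have himage : archCell U Ψ s m = f '' (Ioo (s 0) (s m) ×ˢ Ioo 0 1) := by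
    ext p
    constructor
    · rintro ⟨hu, htop, hlow⟩
      have h1 : l (U p.1) < Ψ p.2 := by
        rw [Finset.sup'_lt_iff]
        exact fun i hi => hlow i (Finset.mem_range.1 hi)
      have h2 := hlt _ hu
      have h3 : Ψ p.2 < t (U p.1) := htop
      have h4 : 0 < t (U p.1) - l (U p.1) := by linarith
      refine ⟨(U p.1, (Ψ p.2 - l (U p.1)) / (t (U p.1) - l (U p.1))),
        ⟨hu, div_pos (by linarith) h4, (div_lt_one h4).2 (by linarith)⟩, ?_⟩
      ext
      · simp [f]
      · simp only [f]
        rw [div_mul_cancel₀ _ h4.ne']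
        simp
    · rintro ⟨⟨u, r⟩, ⟨hu, hr0, hr1⟩, rfl⟩
      simp only at hu hr0 hr1
      have h2 := sub_pos.2 (hlt u hu)
      refine ⟨by simpa [f] using hu, ?_, fun i hi => ?_⟩
      · simp only [f, OrderIso.apply_symm_apply]
        show _ < t u
        nlinarith
      · simp only [f, OrderIso.apply_symm_apply]
        have : (u - s i) * (s (i + 1) - u) ≤ l u :=
          Finset.le_sup' (fun i => (u - s i) * (s (i + 1) - u)) (Finset.mem_range.2 hi)
        nlinarith [mul_pos hr0 h2]
  rw [himage]
  exact (isPreconnected_Ioo.prod isPreconnected_Ioo).image _ hf.continuousOn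

theorem archCell_subset_compl : archCell U Ψ s m ⊆ (archPolygon U Ψ s m)ᶜ := by
  rintro p ⟨-, htop, hlow⟩ (hp | hp)
  · exact htop.ne hp.2
  · obtain ⟨i, hi, hp⟩ := mem_iUnion₂.1 hp
    exact (hlow i hi).ne' hp.2

/-- Go down from below the axis or from below a short arch. Go up from above the long arch, or from
above the axis when the abscissa is not strictly between the extreme feet. -/
theorem vertical_ray_of_notMem_archCell (hΨ : Ψ 0 = 0) (hm : 2 ≤ m) (hs : StrictMonoOn s (Iic m))
    {x y : ℝ} (hp : (x, y) ∉ archPolygon U Ψ s m) (hcell : (x, y) ∉ archCell U Ψ s m) :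
    (∀ y' ≥ y, (x, y') ∉ archPolygon U Ψ s m) ∨ ∀ y' ≤ y, (x, y') ∉ archPolygon U Ψ s m := by
  have hmem : ∀ i j, i ≤ m → j ≤ m → i ≤ j → s i ≤ s j := fun i j hi hj hij =>
    hs.monotoneOn (show i ∈ Iic m from hi) (show j ∈ Iic m from hj) hij
  rcases lt_or_ge y 0 with hy | hy
  · refine Or.inr fun y' hy' h => ?_
    rcases h with h | h
    · exact absurd h.1 (not_le.2 (lt_of_le_of_lt hy' hy))
    · obtain ⟨i, hi, h⟩ := mem_iUnion₂.1 h
      exact absurd h.1 (not_le.2 (lt_of_le_of_lt hy' hy))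
  by_cases hx : U x ∈ Ioo (s 0) (s m)
  · by_cases htop : Ψ y < (U x - s 0) * (s m - U x)
    · have : ∃ i < m, Ψ y ≤ (U x - s i) * (s (i + 1) - U x) := by
        by_contra! h
        exact hcell ⟨hx, htop, h⟩
      obtain ⟨i, hi, hyi⟩ := this
      refine Or.inr fun y' hy' h => ?_
      have hyy := Ψ.monotone hy'
      rcases h with ⟨-, h⟩ | h
      · have := arch_height_lt_of_consecutive hm hs hi hx
        simp only at h
        linarith
      · have hpol := h
        obtain ⟨j, hj, h0, h⟩ := mem_iUnion₂.1 h
        simp only at h h0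
        have h0' := (Ψ.nonneg_iff_of_map_zero hΨ y').2 h0
        -- The arch met at `(x, y')` has `U x` between its feet, and there every other consecutive
        -- parabola is nonpositive. So the ray can meet a short arch only at its starting point.
        have hle : (U x - s i) * (s (i + 1) - U x) ≤ (U x - s j) * (s (j + 1) - U x) := by
          rcases lt_trichotomy i j with hij | rfl | hij
          · have h1 := hmem (i + 1) j hi hj.le hij
            have h2 := hmem i (i + 1) hi.le hi (by omega)
            have h3 := mem_Icc_of_mem_arch (U := U) hΨ (hmem j (j + 1) hj.le hj (by omega))
              (p := (x, y')) ⟨h0, h⟩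
            simp only [mem_Icc] at h3
            nlinarith [mul_nonneg (by linarith : 0 ≤ U x - s i)
              (by linarith : 0 ≤ U x - s (i + 1))]
          · exact le_rfl
          · have h1 := hmem (j + 1) i hj hi.le hij
            have h2 := hmem i (i + 1) hi.le hi (by omega)
            have h3 := mem_Icc_of_mem_arch (U := U) hΨ (hmem j (j + 1) hj.le hj (by omega))
              (p := (x, y')) ⟨h0, h⟩
            simp only [mem_Icc] at h3
            nlinarith [mul_nonneg (by linarith : 0 ≤ s i - U x)
              (by linarith : 0 ≤ s (i + 1) - U x)]
        have : y' = y := Ψ.injective (by linarith)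
        exact hp (this ▸ Or.inr hpol)
    · refine Or.inl fun y' hy' h => ?_
      have hyy := Ψ.monotone hy'
      rcases h with h | h
      · have h2 := h.2
        simp only at h2
        have : y' = y := Ψ.injective (by linarith)
        exact hp (this ▸ Or.inl h)
      · obtain ⟨j, hj, -, h⟩ := mem_iUnion₂.1 h
        have := arch_height_lt_of_consecutive hm hs hj hx
        simp only at h
        linarith
  · refine Or.inl fun y' hy' h => ?_
    have hnonpos : Ψ y' ≤ 0 := by
      rw [mem_Ioo, not_and_or, not_lt, not_lt] at hx
      have hle : ∀ i j, i ≤ j → i ≤ m → j ≤ m → (x, y') ∈ arch U Ψ (s i) (s j) → Ψ y' ≤ 0 := by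
        intro i j hij hi hj hmem'
        have h1 := mem_Icc_of_mem_arch hΨ (hmem i j hi hj hij) hmem'
        have h2 := hmem 0 i (Nat.zero_le m) hi (Nat.zero_le i)
        have h3 := hmem j m hj le_rfl hj
        have h4 := hmem'.2
        simp only [mem_Icc] at h1 h4
        rw [h4]
        rcases hx with hx | hx
        · rw [show U x = s i by linarith]
          simp
        · rw [show U x = s j by linarith]
          simp
      rcases h with h | h
      · exact hle 0 m (Nat.zero_le m) (Nat.zero_le m) le_rfl h
      · obtain ⟨j, hj, h⟩ := mem_iUnion₂.1 h
        exact hle j (j + 1) (by omega) hj.le hj h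
    have hy'0 : y' = 0 := by
      refine le_antisymm ?_ (hy.trans hy')
      rwa [← Ψ.le_iff_le, hΨ]
    have : y' = y := by
      have : y' ≥ y := hy'
      linarith
    exact hp (this ▸ h)

/-- A bounded component of the complement of the polygon contains the whole cell. -/
theorem archCell_subset_of_isBounded (hΨ : Ψ 0 = 0) (hm : 2 ≤ m) (hs : StrictMonoOn s (Iic m))
    {p : ℝ × ℝ} (hp : p ∈ (archPolygon U Ψ s m)ᶜ)
    (hb : Bornology.IsBounded (connectedComponentIn (archPolygon U Ψ s m)ᶜ p)) :
    archCell U Ψ s m ⊆ connectedComponentIn (archPolygon U Ψ s m)ᶜ p := by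
  by_cases hcell : p ∈ archCell U Ψ s m
  · exact (isPreconnected_archCell hm hs).subset_connectedComponentIn hcell archCell_subset_compl
  · exact absurd hb
      (not_isBounded_connectedComponentIn (vertical_ray_of_notMem_archCell hΨ hm hs hp hcell))

end Cell

/-! ### Rectangles above the vertices -/

theorem abscissa_strictMono {n : ℕ} (hn : 1 ≤ n) : StrictMono (abscissa n) := by
  have hn0 : (0 : ℝ) < n := by exact_mod_cast hn
  intro i j hij
  have : (i : ℝ) < j := by exact_mod_cast hij
  unfold abscissa
  gcongr

theorem abscissa_mem_Icc {n k : ℕ} (hk : k < n) : abscissa n k ∈ Icc (0 : ℝ) 1 := by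
  have hn0 : (0 : ℝ) < n := by exact_mod_cast (Nat.zero_le k).trans_lt hk
  have h : (k : ℝ) + 1 ≤ n := by exact_mod_cast hk
  refine ⟨by unfold abscissa; positivity, ?_⟩
  rw [abscissa, div_le_one (by positivity)]
  linarith

theorem abscissa_add_le {n i j : ℕ} (hn : 1 ≤ n) (hij : i < j) :
    abscissa n i + 1 / n ≤ abscissa n j := by
  have hn0 : (0 : ℝ) < n := by exact_mod_cast hn
  have h : (i : ℝ) + 1 ≤ j := by exact_mod_cast hij
  have : abscissa n i + 1 / n = (2 * (i + 1 : ℝ) + 1) / (2 * n) := by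
    rw [abscissa]
    field_simp
    ring
  rw [this, abscissa]
  gcongr

/-- The behaviour of a staircase on the strip around the abscissa number `k`. -/
theorem staircase_strip {n : ℕ} {U : ℝ ≃o ℝ}
    (hU : ∀ k < n, ∀ x : ℝ, |x - abscissa n k| ≤ 1 / (3 * n) → U x = x / 4 + k) {k : ℕ}
    (hk : k < n) {x : ℝ} (hx : |x - abscissa n k| ≤ 1 / (3 * n)) :
    |U x - U (abscissa n k)| ≤ 1 / (12 * n) ∧ ∀ i < n, |U x - U (abscissa n i)| ≤ n ∧
      (i < k → 1 ≤ U x - U (abscissa n i)) ∧ (k < i → 1 ≤ U (abscissa n i) - U x) := by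
  have hn : 1 ≤ n := by omega
  have hn0 : (0 : ℝ) < n := by exact_mod_cast hn
  have hUa : ∀ i < n, U (abscissa n i) = abscissa n i / 4 + i := fun i hi =>
    hU i hi _ (by rw [sub_self, abs_zero]; positivity)
  have h12 : 1 / (12 * (n : ℝ)) = 1 / (3 * n) / 4 := by
    field_simp
    norm_num
  have h3 : 3 * (1 / (3 * (n : ℝ))) = 1 / n := by field_simp
  have h6 : 1 / (3 * (n : ℝ)) ≤ 1 := by
    rw [div_le_one (by positivity)]
    have : (1 : ℝ) ≤ n := by exact_mod_cast hn
    linarith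
  have hpos : 0 < 1 / (3 * (n : ℝ)) := by positivity
  obtain ⟨hx1, hx2⟩ := abs_le.1 hx
  rw [hU k hk x hx, hUa k hk]
  refine ⟨?_, fun i hi => ?_⟩
  · rw [h12, abs_le]
    constructor <;> linarith
  · rw [hUa i hi]
    obtain ⟨ha, ha'⟩ := abscissa_mem_Icc hi
    obtain ⟨hb, hb'⟩ := abscissa_mem_Icc hk
    have hin : (i : ℝ) + 1 ≤ n := by exact_mod_cast hi
    have hkn : (k : ℝ) + 1 ≤ n := by exact_mod_cast hk
    have hi0 : (0 : ℝ) ≤ i := Nat.cast_nonneg i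
    have hk0 : (0 : ℝ) ≤ k := Nat.cast_nonneg k
    -- The indices differ by at most `n - 1`, and the linear part `x / 4` contributes at most `1 /
    -- 2`.
    refine ⟨abs_le.2 ⟨by linarith, by linarith⟩, fun hik => ?_, fun hki => ?_⟩
    · have h1 := abscissa_add_le hn hik
      have h2 : (i : ℝ) + 1 ≤ k := by exact_mod_cast hik
      linarith
    · have h1 := abscissa_add_le hn hki
      have h2 : (k : ℝ) + 1 ≤ i := by exact_mod_cast hki
      linarith

/-- The rectangle above the vertex number `k`. -/
def vertexRectangle (n k : ℕ) : Set (ℝ × ℝ) :=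
  Icc (abscissa n k - 1 / (3 * n)) (abscissa n k + 1 / (3 * n)) ×ˢ Icc (1 / 4) (3 / 4)

theorem isClosedRectangle_vertexRectangle {n : ℕ} (hn : 1 ≤ n) (k : ℕ) :
    IsClosedRectangle (vertexRectangle n k) := by
  have hpos : 0 < 1 / (3 * (n : ℝ)) := by
    have : (0 : ℝ) < n := by exact_mod_cast hn
    positivity
  exact ⟨_, _, _, _, by linarith, by norm_num, rfl⟩

theorem volume_vertexRectangle {n : ℕ} (hn : 1 ≤ n) (k : ℕ) :
    volume (vertexRectangle n k) = ENNReal.ofReal (1 / (3 * (n : ℝ))) := by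
  have hpos : 0 < 1 / (3 * (n : ℝ)) := by
    have : (0 : ℝ) < n := by exact_mod_cast hn
    positivity
  rw [vertexRectangle, Measure.volume_eq_prod, Measure.prod_prod, Real.volume_Icc, Real.volume_Icc,
    ← ENNReal.ofReal_mul (by linarith)]
  congr 1
  ring

theorem disjoint_vertexRectangle {n : ℕ} (hn : 1 ≤ n) {i j : ℕ} (hij : i ≠ j) :
    Disjoint (vertexRectangle n i) (vertexRectangle n j) := by
  have hn0 : (0 : ℝ) < n := by exact_mod_cast hn
  have h3 : 3 * (1 / (3 * (n : ℝ))) = 1 / n := by field_simp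
  have hpos : 0 < 1 / (3 * (n : ℝ)) := by positivity
  have key : ∀ i j, i < j → Disjoint (vertexRectangle n i) (vertexRectangle n j) := by
    intro i j h
    have h1 := abscissa_add_le hn h
    refine Set.disjoint_left.2 fun p hp hq => ?_
    have h2 := hp.1.2
    have h4 := hq.1.1
    linarith
  rcases hij.lt_or_gt with h | h
  · exact key i j h
  · exact (key j i h).symm

section Rectangles

variable {n : ℕ} {U Ψ : ℝ ≃o ℝ}

/-- Both factors of the height are at least `1`, while the rectangle stops at `3 / 4`. -/
theorem lt_arch_height_of_mem_vertexRectangle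
    (hU : ∀ k < n, ∀ x : ℝ, |x - abscissa n k| ≤ 1 / (3 * n) → U x = x / 4 + k)
    (hΨ : ∀ y ≤ 3 / 4, Ψ y = y) {i j k : ℕ} (hik : i < k) (hkj : k < j) (hj : j < n)
    {p : ℝ × ℝ} (hp : p ∈ vertexRectangle n k) :
    Ψ p.2 < (U p.1 - U (abscissa n i)) * (U (abscissa n j) - U p.1) := by
  have hx : |p.1 - abscissa n k| ≤ 1 / (3 * n) :=
    abs_le.2 ⟨by linarith [hp.1.1], by linarith [hp.1.2]⟩
  have h := (staircase_strip hU (hkj.trans hj) hx).2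
  have h1 := (h i (by omega)).2.1 hik
  have h2 := (h j hj).2.2 hkj
  have h3 := hp.2.2
  rw [hΨ _ h3]
  nlinarith

/-- If the arch ends at vertex `k`, one factor is at most `1 / (12 n)` and the other at most `n` in
absolute value, giving `1 / 12 < 1 / 4`. Otherwise the factors have opposite signs. -/
theorem arch_height_lt_of_mem_vertexRectangle
    (hU : ∀ k < n, ∀ x : ℝ, |x - abscissa n k| ≤ 1 / (3 * n) → U x = x / 4 + k)
    (hΨ : ∀ y ≤ 3 / 4, Ψ y = y) {i j k : ℕ} (hij : i < j) (hj : j < n)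
    (hk : k < n) (hkij : k ≤ i ∨ j ≤ k) {p : ℝ × ℝ} (hp : p ∈ vertexRectangle n k) :
    (U p.1 - U (abscissa n i)) * (U (abscissa n j) - U p.1) < Ψ p.2 := by
  have hn0 : (0 : ℝ) < n := by exact_mod_cast (Nat.zero_le k).trans_lt hk
  have hx : |p.1 - abscissa n k| ≤ 1 / (3 * n) :=
    abs_le.2 ⟨by linarith [hp.1.1], by linarith [hp.1.2]⟩
  obtain ⟨h0, h⟩ := staircase_strip hU hk hx
  have h12 : 1 / (12 * (n : ℝ)) * n = 1 / 12 := by field_simp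
  rw [hΨ _ hp.2.2]
  have h3 : (1 / 4 : ℝ) ≤ p.2 := hp.2.1
  rcases hkij with hki | hjk
  · rcases hki.eq_or_lt with rfl | hki
    · have h1 : (U p.1 - U (abscissa n k)) * (U (abscissa n j) - U p.1) ≤ 1 / (12 * (n : ℝ)) * n := by
        refine (le_abs_self _).trans ?_
        rw [abs_mul, abs_sub_comm (U (abscissa n j))]
        exact mul_le_mul h0 (h j hj).1 (abs_nonneg _) (by positivity)
      linarith
    · have h1 := (h i (by omega)).2.2 hki
      have h2 := (h j hj).2.2 (hki.trans hij)
      nlinarith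
  · rcases hjk.eq_or_lt with rfl | hjk
    · have h1 : (U p.1 - U (abscissa n i)) * (U (abscissa n j) - U p.1) ≤
          n * (1 / (12 * (n : ℝ))) := by
        refine (le_abs_self _).trans ?_
        rw [abs_mul, abs_sub_comm (U (abscissa n j))]
        exact mul_le_mul (h i (by omega)).1 h0 (abs_nonneg _) hn0.le
      linarith
    · have h1 := (h i (by omega)).2.1 (hij.trans hjk)
      have h2 := (h j hj).2.1 hjk
      nlinarith

end Rectangles

/-! ### Faces of plane cycles and the main theorem -/

/-- The trace of a cycle that visits its vertices in increasing order is a polygon of arches. -/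
theorem archDrawing_trace_eq_archPolygon {V : Type*} {U Ψ : ℝ ≃o ℝ} {hΨ : Ψ 0 = 0} {a : V → ℝ}
    {ha : Function.Injective a} {u v : V} {c : (⊤ : SimpleGraph V).Walk v v}
    {d : (⊤ : SimpleGraph V).Walk u u} (hd : 1 ≤ d.length)
    (he : ∀ e, e ∈ d.edges ↔ e ∈ c.edges) :
    (archDrawing U Ψ hΨ a ha).trace c =
      archPolygon U Ψ (fun i => a (d.getVert i)) (d.length - 1) := by
  have hlast : d.getVert (d.length - 1 + 1) = d.getVert 0 := by
    rw [Nat.sub_add_cancel hd]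
    simp
  ext p
  simp only [TopologicalGraph.trace, mem_iUnion, archPolygon, mem_union, exists_prop, ← he,
    SimpleGraph.Walk.mem_edges_iff_exists_getVert]
  constructor
  · rintro ⟨_, ⟨i, hi, rfl⟩, hp⟩
    rw [archDrawing_curve] at hp
    -- The closing edge gives the long arch; all other edges give the short ones.
    rcases (Nat.le_sub_one_of_lt hi).eq_or_lt with rfl | hi'
    · rw [hlast, arch_comm] at hp
      exact Or.inl hp
    · exact Or.inr ⟨i, hi', hp⟩
  · rintro (hp | ⟨i, hi, hp⟩)
    · refine ⟨_, ⟨d.length - 1, by omega, rfl⟩, ?_⟩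
      rw [archDrawing_curve, hlast, arch_comm]
      exact hp
    · exact ⟨_, ⟨i, by omega, rfl⟩, hp⟩

theorem archDrawing_exists_monotone_cycle {V : Type*} [LinearOrder V] {U Ψ : ℝ ≃o ℝ}
    {hΨ : Ψ 0 = 0} {a : V → ℝ} (hmono : StrictMono a) {v : V} {c : (⊤ : SimpleGraph V).Walk v v}
    (hc : (archDrawing U Ψ hΨ a hmono.injective).IsPlaneCycle c) :
    ∃ (u : V) (d : (⊤ : SimpleGraph V).Walk u u), d.IsCycle ∧ (∀ e, e ∈ d.edges ↔ e ∈ c.edges) ∧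
      (∀ x, x ∈ d.support ↔ x ∈ c.support) ∧ StrictMonoOn d.getVert (Iio d.length) ∧
      (d.support.dropLast.IsRotated c.support.tail ∨
        d.support.dropLast.reverse.IsRotated c.support.tail) :=
  hc.1.exists_strictMonoOn_getVert fun _ _ _ _ hab hxy h =>
    hc.2 _ hab _ hxy ((archDrawing_cross_iff hmono (h.1.trans h.2.1) (h.2.1.trans h.2.2)).2
      (Or.inl h))

theorem archDrawing_visitsInIncreasingOrder {n : ℕ} {U Ψ : ℝ ≃o ℝ} {hΨ : Ψ 0 = 0} {a : Fin n → ℝ}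
    (hmono : StrictMono a) {v : Fin n} {c : (⊤ : SimpleGraph (Fin n)).Walk v v}
    (hc : (archDrawing U Ψ hΨ a hmono.injective).IsPlaneCycle c) : VisitsInIncreasingOrder c := by
  obtain ⟨u, d, -, -, -, hinc, hrot⟩ := archDrawing_exists_monotone_cycle hmono hc
  refine ⟨d.support.dropLast, ?_, hrot⟩
  rw [List.pairwise_iff_getElem]
  intro i j hi hj hij
  have hj' : j < d.length := by simpa using hj
  rw [List.getElem_dropLast, List.getElem_dropLast, SimpleGraph.Walk.support_getElem_eq_getVert,
    SimpleGraph.Walk.support_getElem_eq_getVert]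
  exact hinc (hij.trans hj') hj' hij

theorem vertexRectangle_subset_face {n : ℕ} {U Ψ : ℝ ≃o ℝ}
    (hU : ∀ k < n, ∀ x : ℝ, |x - abscissa n k| ≤ 1 / (3 * n) → U x = x / 4 + k)
    (hΨ : ∀ y ≤ 3 / 4, Ψ y = y) {hΨ0 : Ψ 0 = 0}
    (hmono : StrictMono fun k : Fin n => U (abscissa n k)) {v : Fin n}
    {c : (⊤ : SimpleGraph (Fin n)).Walk v v} {F : Set (ℝ × ℝ)}
    (hF : (archDrawing U Ψ hΨ0 _ hmono.injective).IsFaceOf c F) {i : Fin n} (hi : i ∈ c.support)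
    (hlo : ∃ a ∈ c.support, a < i) (hhi : ∃ b ∈ c.support, i < b) :
    vertexRectangle n i ⊆ F := by
  obtain ⟨hc, hb, p, hp, rfl⟩ := hF
  obtain ⟨u, d, hd, he, hs, hinc, -⟩ := archDrawing_exists_monotone_cycle hmono hc
  have h3 := hd.three_le_length
  have htrace := archDrawing_trace_eq_archPolygon (U := U) (hΨ := hΨ0) (ha := hmono.injective)
    (by omega) he
  have hget : ∀ x ∈ c.support, ∃ r ≤ d.length - 1, d.getVert r = x := by
    intro x hx
    obtain ⟨r, hr, hrl⟩ := SimpleGraph.Walk.mem_support_iff_exists_getVert.1 ((hs x).2 hx)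
    -- Index `d.length` repeats the starting vertex, so it is replaced by `0`.
    rcases hrl.eq_or_lt with rfl | hlt
    · exact ⟨0, Nat.zero_le _, by simpa using hr⟩
    · exact ⟨r, by omega, hr⟩
  have hlt : ∀ r s, r ≤ d.length - 1 → s ≤ d.length - 1 →
      (d.getVert r < d.getVert s ↔ r < s) := fun r s hr hs =>
    hinc.lt_iff_lt (show r < d.length by omega) (show s < d.length by omega)
  obtain ⟨r, hr, rfl⟩ := hget i hi
  have hr0 : 0 < r := by
    obtain ⟨a, ha, hai⟩ := hlo
    obtain ⟨t, ht, rfl⟩ := hget a ha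
    have := (hlt _ _ ht hr).1 hai
    omega
  have hrm : r < d.length - 1 := by
    obtain ⟨b, hb, hib⟩ := hhi
    obtain ⟨t, ht, rfl⟩ := hget b hb
    have := (hlt _ _ hr ht).1 hib
    omega
  rw [htrace] at hp hb ⊢
  refine Subset.trans (fun q hq => ?_) (archCell_subset_of_isBounded hΨ0 (by omega) ?_ hp hb)
  · have h0r := (hlt 0 r (Nat.zero_le _) hr).2 hr0
    have hrl := (hlt r (d.length - 1) hr le_rfl).2 hrm
    have hx : |q.1 - abscissa n (d.getVert r)| ≤ 1 / (3 * n) :=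
      abs_le.2 ⟨by linarith [hq.1.1], by linarith [hq.1.2]⟩
    have h := (staircase_strip hU (d.getVert r).2 hx).2
    refine ⟨⟨?_, ?_⟩, lt_arch_height_of_mem_vertexRectangle hU hΨ h0r hrl (Fin.is_lt _) hq,
      fun j hj => arch_height_lt_of_mem_vertexRectangle hU hΨ ?_ (Fin.is_lt _) (Fin.is_lt _) ?_ hq⟩
    · have := (h _ (d.getVert 0).2).2.1 h0r
      linarith
    · have := (h _ (d.getVert (d.length - 1)).2).2.2 hrl
      linarith
    · exact (hlt j (j + 1) hj.le hj).2 (by omega)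
    · rcases le_or_gt r j with hrj | hrj
      · exact Or.inl (not_lt.1 fun h => absurd ((hlt j r hj.le hr).1 h) (not_lt.2 hrj))
      · exact Or.inr (not_lt.1 fun h => absurd ((hlt r (j + 1) hr hj).1 h) (by omega))
  · intro i hi j hj hij
    exact hmono ((hlt i j hi hj).2 hij)

/-- A cycle has at least three vertices, so every face receives at least one full rectangle; this
yields the area bound. -/
theorem exists_intermediate_vertex {V : Type*} [LinearOrder V] {G : SimpleGraph V} {u : V}
    {d : G.Walk u u} (hd : d.IsCycle) (hinc : StrictMonoOn d.getVert (Iio d.length)) :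
    ∃ i ∈ d.support, (∃ a ∈ d.support, a < i) ∧ ∃ b ∈ d.support, i < b := by
  have h3 := hd.three_le_length
  have h0 : 0 ∈ Iio d.length := show 0 < _ by omega
  have h1 : 1 ∈ Iio d.length := show 1 < _ by omega
  have h2 : 2 ∈ Iio d.length := show 2 < _ by omega
  exact ⟨_, d.getVert_mem_support 1, ⟨_, d.getVert_mem_support 0, hinc h0 h1 one_pos⟩,
    _, d.getVert_mem_support 2, hinc h1 h2 one_lt_two⟩

theorem archDrawing_inUnitSquare {n : ℕ} {U Ψ : ℝ ≃o ℝ} {hΨ0 : Ψ 0 = 0}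
    (hU : ∀ k < n, ∀ x : ℝ, |x - abscissa n k| ≤ 1 / (3 * n) → U x = x / 4 + k)
    (hΨ1 : (n : ℝ) ^ 2 ≤ Ψ 1) (hmono : StrictMono fun k : Fin n => U (abscissa n k)) :
    (archDrawing U Ψ hΨ0 _ hmono.injective).InUnitSquare := by
  refine ⟨fun v => ⟨?_, by simp [archDrawing]⟩, fun e _ p hp => ?_⟩
  · simpa only [archDrawing, OrderIso.symm_apply_apply] using abscissa_mem_Icc v.2
  induction e with | _ i j => ?_
  rw [archDrawing_curve] at hp
  wlog hij : i ≤ j generalizing i j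
  · rw [arch_comm] at hp
    exact this j i (by rwa [Sym2.eq_swap]) hp (le_of_not_ge hij)
  obtain ⟨h1, h2⟩ := mem_Icc_of_mem_arch hΨ0 (hmono.monotone hij) hp
  refine ⟨⟨(abscissa_mem_Icc i.2).1.trans (U.le_iff_le.1 h1),
    (U.le_iff_le.1 h2).trans (abscissa_mem_Icc j.2).2⟩, hp.1, ?_⟩
  rw [← Ψ.le_iff_le]
  refine le_trans ?_ hΨ1
  -- Both factors of the height are at most the width of the arch, hence at most `n`; this is why `Ψ
  -- 1` has to reach `n ^ 2`.
  have hdist : U (abscissa n j) - U (abscissa n i) ≤ n := by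
    have hx : |abscissa n j - abscissa n j| ≤ 1 / (3 * n) := by
      rw [sub_self, abs_zero]
      positivity
    exact (le_abs_self _).trans ((staircase_strip hU j.2 hx).2 i i.2).1
  rw [hp.2, sq]
  exact mul_le_mul (by linarith) (by linarith) (by linarith) (Nat.cast_nonneg n)

theorem theorem3 :
    ∀ n : ℕ, 1 ≤ n →
      ∃ D : TopologicalGraph (⊤ : SimpleGraph (Fin n)),
        D.IsSimple ∧ D.InUnitSquare ∧
        -- every generated face has area at least `1 / (3 n)`
        (∀ F : Set (ℝ × ℝ), D.GeneratesFace F →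
          ENNReal.ofReal (1 / (3 * (n : ℝ))) ≤ volume F) ∧
        -- the crossing pattern is that of points in convex position
        (∀ i₁ i₂ i₃ i₄ : Fin n, i₁ < i₂ → i₃ < i₄ →
          (D.Cross s(i₁, i₂) s(i₃, i₄) ↔
            (i₁ < i₃ ∧ i₃ < i₂ ∧ i₂ < i₄) ∨ (i₃ < i₁ ∧ i₁ < i₄ ∧ i₄ < i₂))) ∧
        -- every plane cycle visits its vertices in increasing order
        (∀ (v : Fin n) (c : (⊤ : SimpleGraph (Fin n)).Walk v v),
          D.IsPlaneCycle c → VisitsInIncreasingOrder c) ∧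
        -- the face of a plane cycle contains the rectangles of its intermediate vertices
        (∃ R : Fin n → Set (ℝ × ℝ),
          (∀ i, IsClosedRectangle (R i) ∧ volume (R i) = ENNReal.ofReal (1 / (3 * (n : ℝ)))) ∧
          (∀ i j, i ≠ j → Disjoint (R i) (R j)) ∧
          ∀ (v : Fin n) (c : (⊤ : SimpleGraph (Fin n)).Walk v v) (F : Set (ℝ × ℝ)),
            D.IsFaceOf c F →
              ∀ i ∈ c.support, (∃ a ∈ c.support, a < i) → (∃ b ∈ c.support, i < b) →
                R i ⊆ F) := by
  intro n hn
  obtain ⟨U, hU⟩ := exists_staircase hn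
  obtain ⟨Ψ, hΨ, hΨ1⟩ := exists_steep_orderIso (sq_nonneg (n : ℝ))
  have hΨ0 : Ψ 0 = 0 := hΨ 0 (by norm_num)
  have hmono : StrictMono fun k : Fin n => U (abscissa n k) := fun i j hij =>
    U.strictMono (abscissa_strictMono hn hij)
  refine ⟨archDrawing U Ψ hΨ0 _ hmono.injective, archDrawing_isSimple,
    archDrawing_inUnitSquare hU hΨ1 hmono, ?_, fun i₁ i₂ i₃ i₄ h12 h34 =>
      archDrawing_cross_iff hmono h12 h34, fun v c hc => archDrawing_visitsInIncreasingOrder hmono hc,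
    fun i => vertexRectangle n i, fun i => ⟨isClosedRectangle_vertexRectangle hn i,
      volume_vertexRectangle hn i⟩, fun i j hij => disjoint_vertexRectangle hn (Fin.val_ne_of_ne hij),
    fun v c F hF i hi hlo hhi => vertexRectangle_subset_face hU hΨ hmono hF hi hlo hhi⟩
  rintro F ⟨v, c, hF⟩
  obtain ⟨u, d, hd, -, hs, hinc, -⟩ := archDrawing_exists_monotone_cycle hmono hF.1
  obtain ⟨i, hi, ⟨a, ha, hai⟩, b, hb, hib⟩ := exists_intermediate_vertex hd hinc
  rw [← volume_vertexRectangle hn i]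
  exact measure_mono (vertexRectangle_subset_face hU hΨ hmono hF ((hs i).1 hi)
    ⟨a, (hs a).1 ha, hai⟩ ⟨b, (hs b).1 hb, hib⟩)
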